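/- **Setting.** Let $G=(V,A)$ be a finite directed graph (parallel arcs are allowed) whose arc set is partitioned into a set $A_1$ of tolled arcs and a set $A_2$ of toll-free arcs. Every arc $a$ has an initial cost $c_a>0$. Let $o,d\in V$ be the origin and the destination of a commodity. Let $P$ be the set of elementary paths (paths that repeat no node) from $o$ to $d$. The initial cost of a path $p$ is $c(p)=\sum_{a\in p}c_a$. Call $p\in P$ *bilevel feasible* if there are tolls $T_a\ge 0$ $(a\in A_1)$ such that, for all $q\in P$, $$\sum_{a\in p}c_a+\sum_{a\in p\cap A_1}T_a\;\le\;\sum_{a\in q}c_a+\sum_{a\in q\cap A_1}T_a .$$ Assume that $P$ contains a path without tolled arcs, and that any two different bilevel feasible paths have different initial costs. **Algorithm.** The input is $G$, $o$, $d$, $(c_a)_{a\in A}$ and a bound $N\in\mathbb N$. The algorithm keeps a set $C$ of candidate paths. Each candidate $q$ carries a spur node $s(q)$ on $q$ and a set $R(q)\subseteq A_1$ of excluded tolled arcs. "Shortest" and "cheapest" refer to initial costs, and all ties may be broken arbitrarily. 1. Find a shortest path $p^1$ from $o$ to $d$. Put $C\leftarrow\{p^1\}$, $s(p^1)\leftarrow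 o$, $R(p^1)\leftarrow\varnothing$, $j\leftarrow 1$. 2. While $j\le N$: 1. Output a cheapest path of $C$, call it $p^j$, and remove it from $C$. 2. If $p^j$ has no tolled arc, stop the algorithm. 3. Let $a_1,\dots,a_m$ be the tolled arcs of $p^j$ between $s(p^j)$ and $d$, in order of appearance. Put $\hat s\leftarrow s(p^j)$. For $i=1,\dots,m$: remove from $G$ (for this pass only) the arcs in $R(p^j)\cup\{a_i\}$ and all nodes of $p^j$ that strictly precede $\hat s$. If $d$ can still be reached from $\hat s$, form the path $q^i$ from the part of $p^j$ from $o$ to $\hat s$ followed by a shortest path from $\hat s$ to $d$ in the reduced graph, put $s(q^i)\leftarrow\hat s$ and $R(q^i)\leftarrow R(p^j)\cup\{a_i\}$, and add $q^i$ to $C$. Then put $\hat s\leftarrow$ target of $a_i$. 4. Put $j\leftarrow j+1$. **Theorem.** There is a number $N_0$ such that the following holds for every $N\ge N_0$. The algorithm with bound $N$ can be started and has no infinite execution. Whatever the tie-breaking, it is never asked to select a path from an empty candidate set, it reaches the instruction "stop" (step 2.2) after at most $N_0$ iterations of the main loop, and by then its output includes every bilevel feasible path of the commodity. -/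

import Mathlib

namespace TollEnum

/-- A directed graph (parallel arcs allowed) with node type `V` and arc type `A`, a set of tolled
arcs (all other arcs are toll-free) and positive initial arc costs. -/
structure Network (V A : Type*) where
  src : A → V
  tgt : A → V
  tolled : Set A
  cost : A → ℝ
  cost_pos : ∀ a, 0 < cost a

namespace Network

variable {V A : Type*} (G : Network V A)

/-- The list of arcs `p` is a walk from `u` to `v`. -/
def IsWalk : V → List A → V → Prop
  | u, [], v => u = v
  | u, a :: p, v => G.src a = u ∧ IsWalk (G.tgt a) p v

/-- The nodes visited, in order, by a walk with arcs `p` that starts at `u`. -/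
def nodes (u : V) (p : List A) : List V := u :: p.map G.tgt

/-- `p` is an elementary path from `u` to `v`: a walk that repeats no node. -/
def IsPath (u v : V) (p : List A) : Prop := G.IsWalk u p v ∧ (G.nodes u p).Nodup

/-- The initial cost of a path, that is, its cost when all tolls are zero. -/
def pathCost (p : List A) : ℝ := (p.map G.cost).sum

/-- `p` uses no tolled arc. -/
def TollFree (p : List A) : Prop := ∀ a ∈ p, a ∉ G.tolled

/-- The cost of a path for the follower under the tolls `T`; only the values of `T` on tolled arcs
matter. -/
noncomputable def followerCost (T : A → ℝ) (p : List A) : ℝ :=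
  (p.map fun a => G.cost a + G.tolled.indicator T a).sum

/-- `p` is an elementary path from `o` to `d` that is optimal for the follower under some
nonnegative tolls. -/
def BilevelFeasible (o d : V) (p : List A) : Prop :=
  G.IsPath o d p ∧ ∃ T : A → ℝ, (∀ a ∈ G.tolled, 0 ≤ T a) ∧
    ∀ q, G.IsPath o d q → G.followerCost T p ≤ G.followerCost T q

/-- `p` is a path from `u` to `v` in the graph from which the nodes in `X` and the arcs in `R` have
been removed. -/
def IsPathAvoiding (X : Set V) (R : Set A) (u v : V) (p : List A) : Prop :=
  G.IsPath u v p ∧ (∀ x ∈ G.nodes u p, x ∉ X) ∧ ∀ a ∈ p, a ∉ R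

/-- `p` is a shortest path (for the initial costs) from `u` to `v` in the graph from which the nodes
in `X` and the arcs in `R` have been removed. -/
def IsShortestAvoiding (X : Set V) (R : Set A) (u v : V) (p : List A) : Prop :=
  G.IsPathAvoiding X R u v p ∧
    ∀ q, G.IsPathAvoiding X R u v q → G.pathCost p ≤ G.pathCost q

end Network

/-- A candidate path `q`, cut at its spur node `s(q)`: `root` is the part from the origin to `s(q)`,
`tail` the part from `s(q)` to the destination, and `excluded` is the set `R(q)`. -/
@[ext] structure Candidate (A : Type*) where
  root : List A
  tail : List A
  excluded : Set A

/-- The whole path of a candidate. -/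
def Candidate.path {A : Type*} (q : Candidate A) : List A := q.root ++ q.tail

namespace Network

variable {V A : Type*} (G : Network V A)

/-- The end node of a walk with arcs `p` that starts at `u`. -/
def endNode (u : V) (p : List A) : V := (p.map G.tgt).getLastD u

/-- The nodes that strictly precede the last node of a walk with arcs `p`. -/
def precedingNodes (p : List A) : Set V := {v | ∃ a ∈ p, G.src a = v}

open Classical in
/-- The values taken by the pair (part of the current path from the origin to `ŝ`, arc `aᵢ`) during
the inner loop, in order. The arguments are the part up to `ŝ`, the toll-free arcs scanned since
`ŝ`, and the arcs still to be scanned. After the tolled arc `aᵢ`, `ŝ` becomes the target of `aᵢ`. -/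
noncomputable def branches : List A → List A → List A → List (List A × A)
  | _, _, [] => []
  | root, seg, a :: t =>
    if a ∈ G.tolled then (root, a) :: branches (root ++ seg ++ [a]) [] t
    else branches root (seg ++ [a]) t

/-- `InnerLoop o d R l C C'`: the inner loop, run on the list `l` of pairs (part up to `ŝ`, arc `aᵢ`)
for a current path with excluded arcs `R`, can turn the candidate set `C` into `C'`. In every pass
the nodes strictly preceding `ŝ` and the arcs in `R ∪ {aᵢ}` are removed; if `ŝ` is still connected to
`d`, then some shortest path from `ŝ` to `d` is appended and the result becomes a candidate. -/
inductive InnerLoop (o d : V) (R : Set A) :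
    List (List A × A) → Set (Candidate A) → Set (Candidate A) → Prop
  | done (C : Set (Candidate A)) : InnerLoop o d R [] C C
  | connected {root : List A} {a : A} {l : List (List A × A)} {C C' : Set (Candidate A)}
      (tail : List A)
      (h : G.IsShortestAvoiding (G.precedingNodes root) (insert a R) (G.endNode o root) d tail)
      (hrest : InnerLoop o d R l (insert ⟨root, tail, insert a R⟩ C) C') :
      InnerLoop o d R ((root, a) :: l) C C'
  | disconnected {root : List A} {a : A} {l : List (List A × A)} {C C' : Set (Candidate A)}
      (h : ¬ ∃ p, G.IsPathAvoiding (G.precedingNodes root) (insert a R) (G.endNode o root) d p)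
      (hrest : InnerLoop o d R l C C') :
      InnerLoop o d R ((root, a) :: l) C C'

end Network

/-- A state of the enumeration algorithm, at the head of its main loop: the paths output so far, in
order, the candidate set, and whether the instruction `Stop` has been executed. The loop counter is
`j = output.length + 1`. -/
@[ext] structure State (A : Type*) where
  output : List (List A)
  cands : Set (Candidate A)
  stopped : Prop

namespace Network

variable {V A : Type*} (G : Network V A)

/-- The possible states before the first iteration: the only candidate is some shortest path from
`o` to `d`, with spur node `o` and no excluded arc. -/
def IsInitial (o d : V) (s : State A) : Prop :=
  ∃ p, G.IsShortestAvoiding ∅ ∅ o d p ∧ s = ⟨[], {⟨[], p, ∅⟩}, False⟩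

/-- `q` is a candidate of minimum cost in `C`. -/
def IsCheapest (C : Set (Candidate A)) (q : Candidate A) : Prop :=
  q ∈ C ∧ ∀ q' ∈ C, G.pathCost q.path ≤ G.pathCost q'.path

/-- One iteration of the main loop with bound `N`. Ties among cheapest candidates and among shortest
paths may be broken in any way. -/
inductive Step (o d : V) (N : ℕ) : State A → State A → Prop
  | halt {out : List (List A)} {C : Set (Candidate A)} (q : Candidate A)
      (hN : out.length + 1 ≤ N) (hq : G.IsCheapest C q) (hfree : G.TollFree q.path) :
      Step o d N ⟨out, C, False⟩ ⟨out ++ [q.path], C \ {q}, True⟩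
  | branch {out : List (List A)} {C C' : Set (Candidate A)} (q : Candidate A)
      (hN : out.length + 1 ≤ N) (hq : G.IsCheapest C q) (hfree : ¬ G.TollFree q.path)
      (hloop : G.InnerLoop o d q.excluded (G.branches q.root [] q.tail) (C \ {q}) C') :
      Step o d N ⟨out, C, False⟩ ⟨out ++ [q.path], C', False⟩

/-- `s` is a state reached by some execution of the algorithm with bound `N`. -/
def Reachable (o d : V) (N : ℕ) (s : State A) : Prop :=
  ∃ s₀, G.IsInitial o d s₀ ∧ Relation.ReflTransGen (G.Step o d N) s₀ s

end Network

end TollEnum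

/-! A candidate stands for all elementary paths `root ++ t` with `t` avoiding its excluded arcs, and
is itself the cheapest of them. The invariant is that every bilevel feasible path has been output or
is represented by a candidate.

Branching preserves this by an exchange argument (`BilevelFeasible.eq_of_common_node`). If a
feasible path meets the candidate again after a toll-free stretch of the candidate's tail, splicing
in that stretch costs the follower no more. Optimality then makes the spliced path feasible with the
same initial cost, and distinctness of costs makes the two paths equal. So a represented feasible
path is the candidate itself, or follows it up to some spur node and then avoids the next tolled arc
(`BilevelFeasible.eq_or_mem_branches`).

When a cheapest candidate is toll-free, a similar cost comparison identifies it with any feasible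
path not yet output (`Invariant.mem_output_of_tollFree`). The candidate set cannot run empty
earlier: some toll-free path is feasible, and only paths with tolls have been output.

For termination, with n arcs, a candidate excluding R weighs (n+1)^(n-|R|). Each branching yields at
most n candidates, each lighter by a factor n+1, so the total weight drops
(`InnerLoop.totalWeight_lt`). -/

namespace TollEnum

namespace Network

variable {V A : Type*} (G : Network V A)

/-! ### Walks and paths -/

lemma endNode_cons (u : V) (a : A) (p : List A) :
    G.endNode u (a :: p) = G.endNode (G.tgt a) p := by
  simp only [endNode, List.map_cons, List.getLastD_cons]

lemma isWalk_append {u w : V} {p q : List A} :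
    G.IsWalk u (p ++ q) w ↔ G.IsWalk u p (G.endNode u p) ∧ G.IsWalk (G.endNode u p) q w := by
  induction p generalizing u with
  | nil => simp [IsWalk, endNode]
  | cons a p ih => simp only [List.cons_append, IsWalk, endNode_cons, ih, and_assoc]

lemma IsWalk.endNode_eq {u v : V} {p : List A} (h : G.IsWalk u p v) : G.endNode u p = v := by
  induction p generalizing u with
  | nil => simpa [IsWalk, endNode] using h
  | cons a p ih => rw [endNode_cons]; exact ih h.2

lemma IsWalk.append {u v w : V} {p q : List A} (hp : G.IsWalk u p v) (hq : G.IsWalk v q w) :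
    G.IsWalk u (p ++ q) w := by
  rw [isWalk_append, hp.endNode_eq]
  exact ⟨hp, hq⟩

lemma IsWalk.nodes_append {u v : V} {p : List A} (h : G.IsWalk u p v) (q : List A) :
    G.nodes u (p ++ q) = p.map G.src ++ G.nodes v q := by
  induction p generalizing u with
  | nil => cases h; rfl
  | cons a p ih =>
    have := ih h.2
    simp only [nodes, List.cons_append, List.map_cons] at this ⊢
    rw [this, h.1]

lemma IsPath.exists_suffix {u v x : V} {p : List A} (h : G.IsPath u v p)
    (hx : x ∈ G.nodes u p) : ∃ q, q.Sublist p ∧ G.IsPath x v q := by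
  induction p generalizing u with
  | nil =>
    obtain rfl : x = u := by simpa [nodes] using hx
    exact ⟨[], .refl _, h⟩
  | cons a p ih =>
    by_cases hxu : x = u
    · subst hxu
      exact ⟨_, .refl _, h⟩
    · have hx' : x ∈ G.nodes (G.tgt a) p := by
        simpa [nodes, hxu] using hx
      obtain ⟨q, hq, hq'⟩ := ih ⟨h.1.2, (List.nodup_cons.1 h.2).2⟩ hx'
      exact ⟨q, hq.cons _, hq'⟩

lemma IsWalk.exists_isPath {u v : V} {p : List A} (h : G.IsWalk u p v) :
    ∃ q, q.Sublist p ∧ G.IsPath u v q := by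
  induction p generalizing u with
  | nil => exact ⟨[], .refl _, h, by simp [nodes]⟩
  | cons a p ih =>
    obtain ⟨q, hq, hq'⟩ := ih h.2
    by_cases hu : u ∈ G.nodes (G.tgt a) q
    · obtain ⟨r, hr, hr'⟩ := hq'.exists_suffix G hu
      exact ⟨r, (hr.trans hq).cons _, hr'⟩
    · exact ⟨a :: q, hq.cons_cons _, ⟨h.1, hq'.1⟩, List.nodup_cons.2 ⟨hu, hq'.2⟩⟩

lemma IsPath.nodup {u v : V} {p : List A} (h : G.IsPath u v p) : p.Nodup :=
  (List.nodup_cons.1 h.2).2.of_map _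

lemma finite_isPath [Finite A] (u v : V) : {p | G.IsPath u v p}.Finite := by
  have := Fintype.ofFinite A
  exact (List.finite_length_le A (Fintype.card A)).subset
    fun p hp => (hp.nodup G).length_le_card

/-- Appending a path that avoids the nodes preceding the end of `r` keeps a path elementary. -/
lemma isPathAvoiding_iff {o d : V} {r t₀ : List A} (h : G.IsPath o d (r ++ t₀)) (R : Set A)
    (t : List A) :
    G.IsPathAvoiding (G.precedingNodes r) R (G.endNode o r) d t ↔
      G.IsPath o d (r ++ t) ∧ ∀ a ∈ t, a ∉ R := by
  have hr := ((G.isWalk_append).1 h.1).1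
  have hn := h.2
  rw [hr.nodes_append, List.nodup_append'] at hn
  simp only [IsPathAvoiding, IsPath, G.isWalk_append (p := r), hr.nodes_append, hr, true_and,
    List.nodup_append', hn.1, List.disjoint_right, List.mem_map, precedingNodes, Set.mem_ofPred_eq]
  tauto

/-! ### Costs -/

lemma sum_map_lt_of_sublist {f : A → ℝ} (hf : ∀ a, 0 < f a) {p q : List A} (h : q.Sublist p)
    (hne : q ≠ p) : (q.map f).sum < (p.map f).sum := by
  induction h with
  | slnil => exact absurd rfl hne
  | @cons l₁ l₂ a h ih =>
    rw [List.map_cons, List.sum_cons]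
    by_cases he : l₁ = l₂
    · subst he
      linarith [hf a]
    · linarith [hf a, ih he]
  | @cons_cons l₁ l₂ a h ih =>
    have := ih fun he => hne (by rw [he])
    simpa using this

lemma sum_map_le_of_sublist {f : A → ℝ} (hf : ∀ a, 0 < f a) {p q : List A} (h : q.Sublist p) :
    (q.map f).sum ≤ (p.map f).sum := by
  by_cases he : q = p
  · rw [he]
  · exact (sum_map_lt_of_sublist hf h he).le

lemma indicator_nonneg {T : A → ℝ} (hT : ∀ a ∈ G.tolled, 0 ≤ T a) (a : A) :
    0 ≤ G.tolled.indicator T a :=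
  Set.indicator_nonneg hT a

lemma followerWeight_pos {T : A → ℝ} (hT : ∀ a ∈ G.tolled, 0 ≤ T a) (a : A) :
    0 < G.cost a + G.tolled.indicator T a :=
  add_pos_of_pos_of_nonneg (G.cost_pos a) (G.indicator_nonneg hT a)

lemma pathCost_append (p q : List A) : G.pathCost (p ++ q) = G.pathCost p + G.pathCost q := by
  simp [pathCost]

lemma followerCost_append (T : A → ℝ) (p q : List A) :
    G.followerCost T (p ++ q) = G.followerCost T p + G.followerCost T q := by
  simp [followerCost]

lemma pathCost_le_followerCost {T : A → ℝ} (hT : ∀ a ∈ G.tolled, 0 ≤ T a) (p : List A) :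
    G.pathCost p ≤ G.followerCost T p :=
  List.sum_le_sum fun a _ => le_add_of_nonneg_right (G.indicator_nonneg hT a)

lemma TollFree.followerCost_eq {p : List A} (h : G.TollFree p) (T : A → ℝ) :
    G.followerCost T p = G.pathCost p := by
  unfold followerCost pathCost
  congr 1
  exact List.map_congr_left fun a ha => by simp [Set.indicator_of_notMem (h a ha)]

/-- Setting every toll to the cost of a cheapest toll-free path makes any path with a tolled arc
dearer than it. -/
lemma exists_bilevelFeasible_tollFree [Finite A] {o d : V}
    (hfree : ∃ p, G.IsPath o d p ∧ G.TollFree p) :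
    ∃ p, G.BilevelFeasible o d p ∧ G.TollFree p := by
  obtain ⟨p, ⟨hp, hpf⟩, hmin⟩ := Set.exists_min_image {p | G.IsPath o d p ∧ G.TollFree p}
    G.pathCost ((G.finite_isPath o d).subset fun _ h => h.1) hfree
  have hnonneg : 0 ≤ G.pathCost p := List.sum_nonneg fun x hx => by
    obtain ⟨a, -, rfl⟩ := List.mem_map.1 hx
    exact (G.cost_pos a).le
  have hT : ∀ a ∈ G.tolled, 0 ≤ (fun _ : A => G.pathCost p) a := fun _ _ => hnonneg
  refine ⟨p, ⟨hp, fun _ => G.pathCost p, hT, fun q hq => ?_⟩, hpf⟩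
  rw [hpf.followerCost_eq]
  by_cases hqf : G.TollFree q
  · rw [hqf.followerCost_eq]
    exact hmin q ⟨hq, hqf⟩
  · simp only [TollFree, not_forall, not_not] at hqf
    obtain ⟨a, ha, hat⟩ := hqf
    have h := sum_map_le_of_sublist (G.followerWeight_pos hT) (List.singleton_sublist.2 ha)
    simp only [List.map_cons, List.map_nil, List.sum_cons, List.sum_nil,
      Set.indicator_of_mem hat] at h
    have := G.cost_pos a
    unfold followerCost
    linarith

/-! ### Exchange of toll-free subpaths -/

/-- A path that is optimal among the continuations of `r` avoiding `R`. -/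
def IsBestTail (o d : V) (r : List A) (R : Set A) (t : List A) : Prop :=
  (G.IsPath o d (r ++ t) ∧ ∀ a ∈ t, a ∉ R) ∧
    ∀ t', (G.IsPath o d (r ++ t') ∧ ∀ a ∈ t', a ∉ R) → G.pathCost t ≤ G.pathCost t'

/-- Deleting the nodes before the spur node amounts to requiring the whole path to be elementary, so
later arguments need no node sets. -/
lemma isShortestAvoiding_iff {o d : V} {r t₀ : List A} (h : G.IsPath o d (r ++ t₀)) (R : Set A)
    (t : List A) :
    G.IsShortestAvoiding (G.precedingNodes r) R (G.endNode o r) d t ↔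
      G.IsBestTail o d r R t := by
  simp only [IsShortestAvoiding, IsBestTail, G.isPathAvoiding_iff h]

/-- The continuations of a best tail after a common part are best tails. -/
lemma IsBestTail.drop {o d : V} {r : List A} {R : Set A} {s t : List A}
    (h : G.IsBestTail o d r R (s ++ t)) : G.IsBestTail o d (r ++ s) R t := by
  obtain ⟨⟨h1, h2⟩, h3⟩ := h
  refine ⟨⟨by simpa using h1, fun a ha => h2 a (by simp [ha])⟩, fun t' ⟨h4, h5⟩ => ?_⟩
  have := h3 (s ++ t') ⟨by simpa using h4, fun a ha => ?_⟩
  · rw [pathCost_append, pathCost_append] at this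
    linarith
  · rcases List.mem_append.1 ha with ha | ha
    · exact h2 a (by simp [ha])
    · exact h5 a ha

/-- A best tail costs no more than a walk that may repeat nodes, provided that the nodes on the
root are avoided. -/
lemma IsBestTail.pathCost_le_of_isWalk {o d : V} {r : List A} {R : Set A} {t w : List A}
    (h : G.IsBestTail o d r R t) (hw : G.IsWalk (G.endNode o r) w d)
    (hX : ∀ x ∈ G.nodes (G.endNode o r) w, x ∉ G.precedingNodes r) (hR : ∀ a ∈ w, a ∉ R) :
    G.pathCost t ≤ G.pathCost w := by
  obtain ⟨q, hq, hqp⟩ := hw.exists_isPath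
  refine (h.2 q ((G.isPathAvoiding_iff h.1.1 R q).1 ⟨hqp, fun x hx => hX x ?_, fun a ha =>
    hR a (hq.subset ha)⟩)).trans (sum_map_le_of_sublist G.cost_pos hq)
  exact ((hq.map G.tgt).cons_cons _).subset hx

lemma BilevelFeasible.eq_of_common_node {o d v : V}
    (hcost : ∀ p q, G.BilevelFeasible o d p → G.BilevelFeasible o d q → p ≠ q →
      G.pathCost p ≠ G.pathCost q)
    {r s z x y : List A} {R : Set A} (hbest : G.IsBestTail o d r R (s ++ z))
    (hs : G.TollFree s) (hp : G.BilevelFeasible o d (r ++ (x ++ y)))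
    (hR : ∀ a ∈ x, a ∉ R) (hsv : G.IsWalk (G.endNode o r) s v)
    (hxv : G.IsWalk (G.endNode o r) x v) : x = s := by
  obtain ⟨hpath, T, hT, hopt⟩ := hp
  have hr := ((G.isWalk_append).1 hpath.1).1
  have hxy := ((G.isWalk_append).1 hpath.1).2
  have hy : G.IsWalk v y d := by simpa [hxv.endNode_eq] using ((G.isWalk_append).1 hxy).2
  have hsz := ((G.isWalk_append).1 hbest.1.1.1).2
  have hz : G.IsWalk v z d := by simpa [hsv.endNode_eq] using ((G.isWalk_append).1 hsz).2
  have h1 : G.pathCost s ≤ G.pathCost x := by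
    -- `x` and `z` come from different paths and may share nodes, so the comparison is with a walk.
    have h := hbest.pathCost_le_of_isWalk G (hxv.append G hz) ?_ ?_
    · rw [pathCost_append, pathCost_append] at h
      linarith
    · have hX := ((G.isPathAvoiding_iff hpath ∅ (x ++ y)).2 ⟨hpath, by simp⟩).2.1
      have hZ := ((G.isPathAvoiding_iff hbest.1.1 R (s ++ z)).2 hbest.1).2.1
      simp only [nodes, List.map_append, List.mem_cons, List.mem_append] at hX hZ ⊢
      rintro w (hw | hw | hw)
      · exact hX w (.inl hw)
      · exact hX w (.inr (.inl hw))
      · exact hZ w (.inr (.inr hw))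
    · intro a ha
      rcases List.mem_append.1 ha with ha | ha
      · exact hR a ha
      · exact hbest.1.2 a (by simp [ha])
  have hwalk : G.IsWalk o (r ++ (s ++ y)) d := hr.append G (hsv.append G hy)
  obtain ⟨q, hq, hqp⟩ := hwalk.exists_isPath
  have h2 := hopt q hqp
  have h3 : G.followerCost T q ≤ G.followerCost T (r ++ (s ++ y)) :=
    sum_map_le_of_sublist (G.followerWeight_pos hT) hq
  have h4 := G.pathCost_le_followerCost hT x
  have h5 := hs.followerCost_eq G T
  -- The spliced walk costs the follower at most as much as the optimal path. A proper shortcut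
  -- would be strictly cheaper, since costs are positive, so the walk is already elementary.
  have hqe : q = r ++ (s ++ y) := by
    by_contra hne
    have h6 : G.followerCost T q < G.followerCost T (r ++ (s ++ y)) :=
      sum_map_lt_of_sublist (G.followerWeight_pos hT) hq hne
    simp only [followerCost_append] at h2 h6
    linarith
  subst hqe
  simp only [followerCost_append] at h2
  by_contra hne
  -- The same tolls support both paths, and optimality turns `h1` into an equality of initial costs.
  refine hcost _ _ ⟨hpath, T, hT, hopt⟩ ⟨hqp, T, hT, fun q' hq' => ?_⟩ ?_ ?_
  · refine le_trans ?_ (hopt q' hq')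
    simp only [followerCost_append]
    linarith
  · simpa using hne
  · simp only [pathCost_append]
    linarith

/-! ### Branching -/

lemma exists_append_of_mem_branches {r : List A} {a : A} {root seg rest : List A}
    (h : (r, a) ∈ branches G root seg rest) :
    a ∈ rest ∧ ∃ t, root ++ seg ++ rest = r ++ t := by
  induction rest generalizing root seg with
  | nil => simp [branches] at h
  | cons b t ih =>
    rw [branches] at h
    split_ifs at h with hb
    · rcases List.mem_cons.1 h with h | h
      · obtain ⟨rfl, rfl⟩ := Prod.mk.inj h
        exact ⟨by simp, seg ++ a :: t, by simp⟩
      · obtain ⟨h1, t', h2⟩ := ih h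
        exact ⟨by simp [h1], t', by simpa using h2⟩
    · obtain ⟨h1, t', h2⟩ := ih h
      exact ⟨by simp [h1], t', by simpa using h2⟩

lemma length_branches_le (root seg rest : List A) :
    (branches G root seg rest).length ≤ rest.length := by
  induction rest generalizing root seg with
  | nil => simp [branches]
  | cons b t ih =>
    rw [branches]
    split_ifs
    · simpa using ih _ _
    · exact (ih _ _).trans (by simp)

/-- Every bilevel feasible path that continues `root` without arcs of `R` is either the best such
path or continues the root of one of the branches. -/
lemma BilevelFeasible.eq_or_mem_branches {o d : V}
    (hcost : ∀ p q, G.BilevelFeasible o d p → G.BilevelFeasible o d q → p ≠ q →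
      G.pathCost p ≠ G.pathCost q)
    {R : Set A} {root seg rest t : List A}
    (hbest : G.IsBestTail o d root R (seg ++ rest)) (hseg : G.TollFree seg)
    (hp : G.BilevelFeasible o d (root ++ t)) (ht : ∀ a ∈ t, a ∉ R) :
    t = seg ++ rest ∨ ∃ r a t', (r, a) ∈ branches G root seg rest ∧ root ++ t = r ++ t' ∧
      ∀ b ∈ t', b ∉ insert a R := by
  induction rest generalizing root seg t with
  | nil =>
    left
    have h1 := ((G.isWalk_append).1 hbest.1.1.1).2
    have h2 := ((G.isWalk_append).1 hp.1.1).2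
    rw [List.append_nil] at h1 ⊢
    -- With no arc left to scan, the common node is `d`.
    exact BilevelFeasible.eq_of_common_node G hcost (y := []) hbest hseg (by simpa using hp) ht
      h1 h2
  | cons a z ih =>
    rw [branches]
    split_ifs with ha
    -- A path using `a` meets the tail at the source of `a`; exchange forces agreement up to there
    -- and the recursion continues beyond `a`. A path missing `a` belongs to the branch excluding
    -- it.
    · by_cases hat : a ∈ t
      · obtain ⟨x, y, rfl⟩ := List.append_of_mem hat
        have h1 := ((G.isWalk_append).1 ((G.isWalk_append).1 hbest.1.1.1).2)
        have h2 := ((G.isWalk_append).1 ((G.isWalk_append).1 hp.1.1).2)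
        obtain rfl : x = seg := by
          refine BilevelFeasible.eq_of_common_node G (v := G.src a) hcost hbest hseg hp
            (fun b hb => ht b (by simp [hb])) ?_ ?_
          · rw [h1.2.1]; exact h1.1
          · rw [h2.2.1]; exact h2.1
        have hb' : G.IsBestTail o d (root ++ x ++ [a]) R ([] ++ z) := by
          have : G.IsBestTail o d root R ((x ++ [a]) ++ z) := by simpa using hbest
          simpa using this.drop
        rcases ih (t := y) hb' (by simp [TollFree]) (by simpa using hp)
          (fun b hb => ht b (by simp [hb])) with h | ⟨r, b, t', h3, h4, h5⟩
        · left; simp [h]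
        · exact .inr ⟨r, b, t', List.mem_cons_of_mem _ h3, by simpa using h4, h5⟩
      · refine .inr ⟨root, a, t, List.mem_cons_self, rfl, fun b hb hbR => ?_⟩
        rcases hbR with rfl | hbR
        · exact hat hb
        · exact ht b hb hbR
    · have := ih (seg := seg ++ [a]) (by simpa using hbest) ?_ hp ht
      · simpa using this
      · intro b hb
        rcases List.mem_append.1 hb with hb | hb
        · exact hseg b hb
        · rw [List.mem_singleton.1 hb]; exact ha

/-! ### Effect of the inner loop on the candidate set -/

lemma exists_innerLoop [Finite A] (o d : V) (R : Set A) (l : List (List A × A))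
    (C : Set (Candidate A)) : ∃ C', G.InnerLoop o d R l C C' := by
  induction l generalizing C with
  | nil => exact ⟨C, .done C⟩
  | cons x l ih =>
    obtain ⟨root, a⟩ := x
    by_cases h : ∃ p, G.IsPathAvoiding (G.precedingNodes root) (insert a R) (G.endNode o root) d p
    · obtain ⟨t, ht, hmin⟩ := Set.exists_min_image _ G.pathCost
        ((G.finite_isPath (G.endNode o root) d).subset fun _ hp => And.left hp) h
      obtain ⟨C', hC'⟩ := ih (insert ⟨root, t, insert a R⟩ C)
      exact ⟨C', .connected t ⟨ht, hmin⟩ hC'⟩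
    · obtain ⟨C', hC'⟩ := ih C
      exact ⟨C', .disconnected h hC'⟩

variable {G}

lemma InnerLoop.subset {o d : V} {R : Set A} {l : List (List A × A)} {C C' : Set (Candidate A)}
    (h : G.InnerLoop o d R l C C') : C ⊆ C' := by
  induction h with
  | done => exact subset_rfl
  | connected t h hrest ih => exact (Set.subset_insert _ _).trans ih
  | disconnected h hrest ih => exact ih

lemma InnerLoop.mem_or {o d : V} {R : Set A} {l : List (List A × A)} {C C' : Set (Candidate A)}
    (h : G.InnerLoop o d R l C C') {q : Candidate A} (hq : q ∈ C') :
    q ∈ C ∨ ∃ a, (q.root, a) ∈ l ∧ q.excluded = insert a R ∧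
      G.IsShortestAvoiding (G.precedingNodes q.root) q.excluded (G.endNode o q.root) d q.tail := by
  induction h with
  | done => exact .inl hq
  | @connected root a l C C' t h hrest ih =>
    rcases ih hq with (rfl | h') | ⟨b, hb, h'⟩
    · exact .inr ⟨a, by simp, rfl, h⟩
    · exact .inl h'
    · exact .inr ⟨b, by simp [hb], h'⟩
  | disconnected h hrest ih =>
    rcases ih hq with h' | ⟨b, hb, h'⟩
    · exact .inl h'
    · exact .inr ⟨b, by simp [hb], h'⟩

lemma InnerLoop.exists_mem {o d : V} {R : Set A} {l : List (List A × A)}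
    {C C' : Set (Candidate A)} (h : G.InnerLoop o d R l C C') {r : List A} {a : A}
    (hra : (r, a) ∈ l) {t : List A}
    (ht : G.IsPathAvoiding (G.precedingNodes r) (insert a R) (G.endNode o r) d t) :
    ∃ q ∈ C', q.root = r ∧ q.excluded = insert a R := by
  induction h with
  | done => simp at hra
  | connected t' h hrest ih =>
    rcases List.mem_cons.1 hra with hra | hra
    · obtain ⟨rfl, rfl⟩ := Prod.mk.inj hra
      exact ⟨_, hrest.subset (Set.mem_insert _ _), rfl, rfl⟩
    · exact ih hra
  | disconnected h hrest ih =>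
    rcases List.mem_cons.1 hra with hra | hra
    · obtain ⟨rfl, rfl⟩ := Prod.mk.inj hra
      exact absurd ⟨t, ht⟩ h
    · exact ih hra

/-! ### A bound for the number of iterations -/

/-- An upper bound for the number of iterations caused by a candidate with excluded arcs `R`. -/
noncomputable def exclusionWeight (R : Set A) : ℕ := (Nat.card A + 1) ^ (Nat.card A - R.ncard)

/-- An upper bound for the number of iterations caused by the candidates in `C`. -/
noncomputable def totalWeight (C : Set (Candidate A)) : ℕ :=
  ∑ᶠ q ∈ C, exclusionWeight q.excluded

lemma totalWeight_insert_le {C : Set (Candidate A)} (hC : C.Finite) (q : Candidate A) :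
    totalWeight (insert q C) ≤ exclusionWeight q.excluded + totalWeight C := by
  by_cases hq : q ∈ C
  · rw [Set.insert_eq_of_mem hq]; exact Nat.le_add_left _ _
  · exact (finsum_mem_insert _ hq hC).le

lemma totalWeight_diff_singleton {C : Set (Candidate A)} (hC : C.Finite) {q : Candidate A}
    (hq : q ∈ C) : exclusionWeight q.excluded + totalWeight (C \ {q}) = totalWeight C := by
  conv_rhs => rw [← Set.insert_sdiff_self_of_mem hq]
  exact (finsum_mem_insert (s := C \ {q}) (fun q => exclusionWeight q.excluded)
    (fun h => h.2 rfl) hC.sdiff).symm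

/-- The enlarged set still has at most `Nat.card A` elements, so the truncated subtraction in the
exponent is genuine. -/
lemma exclusionWeight_insert [Finite A] {R : Set A} {a : A} (ha : a ∉ R) :
    exclusionWeight R = (Nat.card A + 1) * exclusionWeight (insert a R) := by
  have h1 := Set.ncard_insert_of_notMem ha
  have h2 := Set.ncard_le_card (insert a R)
  unfold exclusionWeight
  rw [← pow_succ']
  congr 1
  omega

/-- Each pass adds at most the weight of `R` divided by `Nat.card A + 1`; multiplying through avoids
the division. -/
lemma InnerLoop.finite_and_weight_le [Finite A] {o d : V} {R : Set A} {l : List (List A × A)}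
    {C C' : Set (Candidate A)} (h : G.InnerLoop o d R l C C') (hC : C.Finite)
    (hl : ∀ x ∈ l, x.2 ∉ R) :
    C'.Finite ∧ (Nat.card A + 1) * totalWeight C' ≤
      (Nat.card A + 1) * totalWeight C + l.length * exclusionWeight R := by
  induction h with
  | done => exact ⟨hC, by simp⟩
  | @connected root a l C C' t h hrest ih =>
    obtain ⟨h1, h2⟩ := ih (hC.insert _) fun x hx => hl x (by simp [hx])
    refine ⟨h1, h2.trans ?_⟩
    have h3 := Nat.mul_le_mul_left (Nat.card A + 1)
      (totalWeight_insert_le hC ⟨root, t, insert a R⟩)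
    rw [mul_add, ← exclusionWeight_insert (hl (root, a) (by simp))] at h3
    rw [List.length_cons, add_one_mul (List.length _)]
    omega
  | disconnected h hrest ih =>
    obtain ⟨h1, h2⟩ := ih hC fun x hx => hl x (by simp [hx])
    refine ⟨h1, h2.trans ?_⟩
    rw [List.length_cons, add_one_mul (List.length _)]
    omega

lemma exclusionWeight_pos (R : Set A) : 0 < exclusionWeight R := Nat.pow_pos (Nat.succ_pos _)

/-- Processing a candidate decreases the total weight. -/
lemma InnerLoop.totalWeight_lt [Finite A] {o d : V} {q : Candidate A} {l : List (List A × A)}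
    {C C' : Set (Candidate A)} (h : G.InnerLoop o d q.excluded l (C \ {q}) C') (hC : C.Finite)
    (hq : q ∈ C) (hl : ∀ x ∈ l, x.2 ∉ q.excluded) (hlen : l.length ≤ Nat.card A) :
    totalWeight C' < totalWeight C := by
  have h1 := (h.finite_and_weight_le hC.sdiff hl).2
  have h2 := totalWeight_diff_singleton hC hq
  have h3 := Nat.mul_le_mul_right (exclusionWeight q.excluded) hlen
  have h4 := exclusionWeight_pos q.excluded
  refine Nat.lt_of_mul_lt_mul_left (a := Nat.card A + 1) ?_
  rw [← h2, mul_add, add_one_mul (Nat.card A) (exclusionWeight q.excluded)]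
  omega

/-! ### The invariant of the main loop -/

variable (G)

/-- The invariant of the main loop, as long as the algorithm has not stopped. -/
structure Invariant (o d : V) (out : List (List A)) (C : Set (Candidate A)) : Prop where
  finite : C.Finite
  best : ∀ q ∈ C, G.IsBestTail o d q.root q.excluded q.tail
  weight : out.length + totalWeight C ≤ (Nat.card A + 1) ^ Nat.card A
  tolled : ∀ p ∈ out, ¬ G.TollFree p
  cover : ∀ p, G.BilevelFeasible o d p → p ∈ out ∨
    ∃ q ∈ C, ∃ t, p = q.root ++ t ∧ ∀ a ∈ t, a ∉ q.excluded

variable {G}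

lemma IsInitial.invariant {o d : V} {s : State A} (h : G.IsInitial o d s) :
    ¬ s.stopped ∧ G.Invariant o d s.output s.cands := by
  obtain ⟨p, hp, rfl⟩ := h
  refine ⟨not_false, Set.finite_singleton _, ?_, ?_, by simp, fun p' _ => .inr ?_⟩
  · rintro q rfl
    have h0 : G.precedingNodes [] = ∅ := by simp [precedingNodes]
    have h := G.isShortestAvoiding_iff (r := []) (t₀ := p) hp.1.1 ∅ p
    rw [h0] at h
    exact h.1 hp
  -- The sole candidate excludes nothing, so its weight is exactly the bound.
  · simp [totalWeight, exclusionWeight]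
  · exact ⟨_, rfl, p', rfl, by simp⟩

lemma Invariant.branch [Finite A] {o d : V}
    (hcost : ∀ p q, G.BilevelFeasible o d p → G.BilevelFeasible o d q → p ≠ q →
      G.pathCost p ≠ G.pathCost q)
    {out : List (List A)} {C C' : Set (Candidate A)} (h : G.Invariant o d out C)
    {q : Candidate A} (hq : q ∈ C) (hfree : ¬ G.TollFree q.path)
    (hloop : G.InnerLoop o d q.excluded (branches G q.root [] q.tail) (C \ {q}) C') :
    G.Invariant o d (out ++ [q.path]) C' := by
  have := Fintype.ofFinite A
  have hqb := h.best q hq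
  have hl : ∀ x ∈ branches G q.root [] q.tail, x.2 ∉ q.excluded := fun x hx =>
    hqb.1.2 _ (G.exists_append_of_mem_branches hx).1
  have hlen : (branches G q.root [] q.tail).length ≤ Nat.card A := by
    rw [Nat.card_eq_fintype_card]
    exact (G.length_branches_le _ _ _).trans
      ((hqb.1.1.nodup G).of_append_right).length_le_card
  have hprefix : ∀ {r a}, (r, a) ∈ branches G q.root [] q.tail → ∃ t, G.IsPath o d (r ++ t) := by
    intro r a hra
    obtain ⟨-, t, ht⟩ := G.exists_append_of_mem_branches hra
    exact ⟨t, by rw [← ht]; simpa using hqb.1.1⟩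
  refine ⟨(hloop.finite_and_weight_le h.finite.sdiff hl).1, fun q' hq' => ?_, ?_, ?_, ?_⟩
  · rcases hloop.mem_or hq' with hq' | ⟨a, ha, -, hs⟩
    · exact h.best q' hq'.1
    · obtain ⟨t, ht⟩ := hprefix ha
      exact (G.isShortestAvoiding_iff ht _ _).1 hs
  · have h1 := hloop.totalWeight_lt h.finite hq hl hlen
    have h2 := h.weight
    rw [List.length_append, List.length_singleton]
    omega
  · intro p hp
    rcases List.mem_append.1 hp with hp | hp
    · exact h.tolled p hp
    · rw [List.mem_singleton.1 hp]; exact hfree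
  · intro p hp
    rcases h.cover p hp with hpo | ⟨q', hq', t, rfl, ht⟩
    · exact .inl (by simp [hpo])
    by_cases he : q' = q
    · subst he
      rcases BilevelFeasible.eq_or_mem_branches G hcost (seg := []) hqb (by simp [TollFree]) hp ht
        with rfl | ⟨r, a, t', hra, heq, ht'⟩
      · exact .inl (by simp [Candidate.path])
      · rw [heq] at hp ⊢
        obtain ⟨t₀, ht₀⟩ := hprefix hra
        -- The feasible path itself shows that `d` is still reachable in this pass, so a candidate
        -- was added.
        obtain ⟨q'', hq'', rfl, hR⟩ :=
          hloop.exists_mem hra ((G.isPathAvoiding_iff ht₀ _ _).2 ⟨hp.1, ht'⟩)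
        exact .inr ⟨q'', hq'', t', rfl, by rwa [hR]⟩
    · exact .inr ⟨q', hloop.subset ⟨hq', he⟩, t, rfl, ht⟩

/-- Once the cheapest candidate is toll-free, all bilevel feasible paths have been output. -/
lemma Invariant.mem_output_of_tollFree {o d : V}
    (hcost : ∀ p q, G.BilevelFeasible o d p → G.BilevelFeasible o d q → p ≠ q →
      G.pathCost p ≠ G.pathCost q)
    {out : List (List A)} {C : Set (Candidate A)} (h : G.Invariant o d out C)
    {q : Candidate A} (hq : G.IsCheapest C q) (hfree : G.TollFree q.path)
    {p : List A} (hp : G.BilevelFeasible o d p) : p ∈ out ++ [q.path] := by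
  rcases h.cover p hp with hpo | ⟨q', hq', t, rfl, ht⟩
  · simp [hpo]
  have h1 : G.pathCost q.path ≤ G.pathCost (q'.root ++ t) := by
    refine (hq.2 q' hq').trans ?_
    have := (h.best q' hq').2 t ⟨hp.1, ht⟩
    rw [Candidate.path, pathCost_append, pathCost_append]
    linarith
  have hqp : G.IsPath o d q.path := (h.best q hq.1).1.1
  obtain ⟨T, hT, hopt⟩ := hp.2
  have h2 := hopt _ hqp
  -- With `h1` and `h2` this closes a cycle of inequalities, so the two initial costs agree.
  have h3 := G.pathCost_le_followerCost hT (q'.root ++ t)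
  rw [hfree.followerCost_eq] at h2
  have hqf : G.BilevelFeasible o d q.path := by
    refine ⟨hqp, T, hT, fun p' hp' => ?_⟩
    rw [hfree.followerCost_eq]
    linarith [hopt p' hp']
  by_cases he : q'.root ++ t = q.path
  · simp [he]
  · exact absurd (by linarith) (hcost _ _ hp hqf he)

lemma Invariant.nonempty [Finite A] {o d : V} (hfree : ∃ p, G.IsPath o d p ∧ G.TollFree p)
    {out : List (List A)} {C : Set (Candidate A)} (h : G.Invariant o d out C) : C.Nonempty := by
  obtain ⟨p, hp, hpf⟩ := G.exists_bilevelFeasible_tollFree hfree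
  rcases h.cover p hp with hpo | ⟨q, hq, -⟩
  · exact absurd hpf (h.tolled p hpo)
  · exact ⟨q, hq⟩

/-- A remaining candidate weighs at least 1, which leaves room for one more output. -/
lemma Invariant.length_lt {o d : V} {out : List (List A)} {C : Set (Candidate A)}
    (h : G.Invariant o d out C) (hne : C.Nonempty) :
    out.length + 1 ≤ (Nat.card A + 1) ^ Nat.card A := by
  obtain ⟨q, hq⟩ := hne
  have h1 := totalWeight_diff_singleton h.finite hq
  have h2 := exclusionWeight_pos q.excluded
  have h3 := h.weight
  omega

lemma Invariant.exists_step [Finite A] {o d : V} {N : ℕ}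
    (hN : (Nat.card A + 1) ^ Nat.card A ≤ N) (hfree : ∃ p, G.IsPath o d p ∧ G.TollFree p)
    {out : List (List A)} {C : Set (Candidate A)} (h : G.Invariant o d out C) :
    ∃ s', G.Step o d N ⟨out, C, False⟩ s' := by
  have hne := h.nonempty hfree
  have hlen := (h.length_lt hne).trans hN
  obtain ⟨q, hq, hmin⟩ := Set.exists_min_image C (fun q => G.pathCost q.path) h.finite hne
  by_cases hqf : G.TollFree q.path
  · exact ⟨_, .halt q hlen ⟨hq, hmin⟩ hqf⟩
  · obtain ⟨C', hC'⟩ := G.exists_innerLoop o d q.excluded (branches G q.root [] q.tail) (C \ {q})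
    exact ⟨_, .branch q hlen ⟨hq, hmin⟩ hqf hC'⟩

lemma Step.length_output {o d : V} {N : ℕ} {s s' : State A} (h : G.Step o d N s s') :
    s.output.length + 1 ≤ N ∧ s'.output.length = s.output.length + 1 := by
  cases h <;> exact ⟨‹_›, by simp⟩

lemma Reachable.invariant_or_stopped [Finite A] {o d : V} {N : ℕ}
    (hfree : ∃ p, G.IsPath o d p ∧ G.TollFree p)
    (hcost : ∀ p q, G.BilevelFeasible o d p → G.BilevelFeasible o d q → p ≠ q →
      G.pathCost p ≠ G.pathCost q)
    {s : State A} (h : G.Reachable o d N s) :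
    (¬ s.stopped ∧ G.Invariant o d s.output s.cands) ∨
      (s.stopped ∧ s.output.length ≤ (Nat.card A + 1) ^ Nat.card A ∧
        ∀ p, G.BilevelFeasible o d p → p ∈ s.output) := by
  obtain ⟨s₀, h₀, h⟩ := h
  induction h with
  | refl => exact .inl h₀.invariant
  | tail _ hstep ih =>
    cases hstep with
    | halt q hN hq hqf =>
      rcases ih with ⟨-, ih⟩ | ⟨hs, -⟩
      · refine .inr ⟨trivial, ?_, fun p hp => ih.mem_output_of_tollFree hcost hq hqf hp⟩
        simpa using ih.length_lt (ih.nonempty hfree)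
      · exact hs.elim
    | branch q hN hq hqf hloop =>
      rcases ih with ⟨-, ih⟩ | ⟨hs, -⟩
      · exact .inl ⟨not_false, ih.branch hcost hq.1 hqf hloop⟩
      · exact hs.elim

lemma exists_isInitial [Finite A] {o d : V} (h : ∃ p, G.IsPath o d p) :
    ∃ s, G.IsInitial o d s := by
  obtain ⟨p, hp, hmin⟩ := Set.exists_min_image _ G.pathCost (G.finite_isPath o d) h
  exact ⟨_, p, ⟨⟨hp, by simp, by simp⟩, fun q hq => hmin q hq.1⟩, rfl⟩

end Network

end TollEnum

/-! ### Termination and completeness of every execution -/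

theorem mainTheorem3 {V A : Type*} [Finite V] [Finite A] (G : TollEnum.Network V A) (o d : V)
    (hfree : ∃ p, G.IsPath o d p ∧ G.TollFree p)
    (hcost : ∀ p q, G.BilevelFeasible o d p → G.BilevelFeasible o d q → p ≠ q →
      G.pathCost p ≠ G.pathCost q) :
    ∃ N₀ : ℕ, ∀ N : ℕ, N₀ ≤ N →
      -- the algorithm can start, and it has no infinite execution
      (∃ s, G.IsInitial o d s) ∧
      (¬ ∃ f : ℕ → TollEnum.State A,
        G.IsInitial o d (f 0) ∧ ∀ n, G.Step o d N (f n) (f (n + 1))) ∧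
      -- every execution makes at most `N₀` iterations, and it never ends before the instruction
      -- `Stop`, at which point every bilevel feasible path has been output
      (∀ s, G.Reachable o d N s →
        s.output.length ≤ N₀ ∧
        ((∃ s', G.Step o d N s s') ∨
          (s.stopped ∧ ∀ p, G.BilevelFeasible o d p → p ∈ s.output))) := by
  refine ⟨(Nat.card A + 1) ^ Nat.card A, fun N hN => ⟨?_, ?_, fun s hs => ?_⟩⟩
  · obtain ⟨p, hp, -⟩ := hfree
    exact TollEnum.Network.exists_isInitial ⟨p, hp⟩
  · rintro ⟨f, -, hf⟩
    -- Every step outputs one path and is allowed only below `N` outputs, so step `N` of an infinite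
    -- run is impossible.
    have hlen : ∀ n, n ≤ (f n).output.length := by
      intro n
      induction n with
      | zero => exact Nat.zero_le _
      | succ n ih => rw [(hf n).length_output.2]; omega
    have h1 := (hf N).length_output.1
    have h2 := hlen N
    omega
  · rcases hs.invariant_or_stopped hfree hcost with ⟨hns, hinv⟩ | ⟨hst, hlen, hall⟩
    · refine ⟨(Nat.le_add_right _ _).trans hinv.weight, .inl ?_⟩
      obtain ⟨out, C, b⟩ := s
      obtain rfl : b = False := eq_false hns
      exact hinv.exists_step hN hfree
    · exact ⟨hlen, .inr ⟨hst, hall⟩⟩
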